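/- Let $\mathbb D$ be the open unit disc, $\mathbb T$ the unit circle with normalized Lebesgue measure $\mathbf m$, $L^2(\mathbb T)=L^2(\mathbb T,\mathbf m)$, and let $H^2(\mathbb D)\subset L^2(\mathbb T)$ be the Hardy space (the functions $h\in L^2(\mathbb T)$ with Fourier coefficients $\widehat h(n)=0$ for all $n<0$), whose elements are also regarded as the analytic functions $h(z)=\sum_{n\ge 0}\widehat h(n)z^n$ on $\mathbb D$. Put $H^2_-(\mathbb D)=L^2(\mathbb T)\ominus H^2(\mathbb D)$, let $S$ be multiplication by the independent variable on $H^2(\mathbb D)$, and let $\mathbf 1(z)=1$ and $\chi(z)=z$. Let $W$ be the unitary operator on $L^2(\mathbb T)$ given by $(Wh)(z)=\overline z\,h(\overline z)$; it maps $H^2(\mathbb D)$ onto $H^2_-(\mathbb D)$. Let $\nu$ be a positive finite Borel measure on $\mathbb D$, let $P^2(\nu)$ be the closure of the analytic polynomials in $L^2(\nu)$, and let $S_\nu$ be multiplication by the independent variable on $P^2(\nu)$. Assume that $P^2(\nu)$ consists of analytic functions with bounded point evaluations, that is, that there is a linear map assigning to each $f\in P^2(\nu)$ a function analytic in $\mathbb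 D$, again denoted by $f$, which represents $f$ $\nu$-almost everywhere, such that to (the class of) a polynomial there is assigned this polynomial, and such that for every $\lambda\in\mathbb D$ the mapping $f\mapsto f(\lambda)$, $P^2(\nu)\to\mathbb C$, is bounded. Assume also that $H^2(\mathbb D)\subset P^2(\nu)$, that is, that for every $h\in H^2(\mathbb D)$ the function $z\mapsto h(z)$ on $\mathbb D$ represents an element of $P^2(\nu)$. Then the natural imbedding $J_\nu\colon H^2(\mathbb D)\to P^2(\nu)$ is bounded. Set $X_0=WJ_\nu^*\colon P^2(\nu)\to H^2_-(\mathbb D)$ and define the operator $T$ on $H^2(\mathbb D)\oplus P^2(\nu)$ by $$T=\begin{pmatrix} S & (\cdot , X_0^*\overline\chi)\mathbf{1} \\ 0 & S_\nu^*\end{pmatrix}.$$ Then $\sigma(T)=\mathbb T$. -/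

import Mathlib

open MeasureTheory Filter Topology
open scoped ENNReal

noncomputable section

namespace QuasiHardy

/-- The open unit disc `𝔻`. -/
abbrev Disc : Type := ↥(Metric.ball (0 : ℂ) 1)

/-- The operator of multiplication by an essentially bounded function `g` on `L²(μ)`. -/
def mulL {α : Type} [MeasurableSpace α] {μ : Measure α} (g : α → ℂ) (hg : MemLp g ∞ μ) :
    Lp ℂ 2 μ →L[ℂ] Lp ℂ 2 μ :=
  (ContinuousLinearMap.mul ℂ ℂ).holderL μ ∞ 2 2 (hg.toLp g)

theorem mulL_coe {α : Type} [MeasurableSpace α] {μ : Measure α} (g : α → ℂ)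
    (hg : MemLp g ∞ μ) (f : Lp ℂ 2 μ) : mulL g hg f =ᵐ[μ] fun x => g x * f x := by
  have h1 := (ContinuousLinearMap.mul ℂ ℂ).coeFn_holder (r := 2) (hg.toLp g) f
  filter_upwards [h1, hg.coeFn_toLp] with x hx hx'
  refine hx.trans ?_
  rw [ContinuousLinearMap.mul_apply', hx']

/-! ### The circle, `H²(𝔻)` and its orthogonal complement

The circle `𝕋` is parametrized by `x ∈ ℝ/ℤ` through `z = exp (2πix)`; the normalized Lebesgue
measure `𝐦` is `AddCircle.haarAddCircle`, and `fourier n` is the function `z ^ n`. -/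

/-- `L²(𝕋) = L²(𝕋, 𝐦)`. -/
abbrev L2T : Type := Lp ℂ 2 (AddCircle.haarAddCircle : Measure UnitAddCircle)

theorem memLp_fourier (n : ℤ) :
    MemLp (fun x : UnitAddCircle => (fourier n x : ℂ)) ∞ AddCircle.haarAddCircle :=
  memLp_top_of_bound (fourier n).continuous.aestronglyMeasurable 1
    (Eventually.of_forall fun x => by rw [fourier_apply, Circle.norm_coe])

/-- `U_𝕋`: multiplication by the independent variable `z` on `L²(𝕋)`. -/
def bilateralShift : L2T →L[ℂ] L2T := mulL _ (memLp_fourier 1)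

/-- The Hardy space `H²(𝔻)`, as the subspace of `L²(𝕋)` of the functions whose Fourier
coefficients of negative index vanish (boundary values). -/
def hardy : Submodule ℂ L2T where
  carrier := {h | ∀ n : ℤ, n < 0 → fourierCoeff (h : UnitAddCircle → ℂ) n = 0}
  zero_mem' := fun n _ => by rw [← fourierBasis_repr]; simp
  add_mem' := fun {a b} ha hb n hn => by
    rw [← fourierBasis_repr, map_add, lp.coeFn_add, Pi.add_apply, fourierBasis_repr,
      fourierBasis_repr, ha n hn, hb n hn, add_zero]
  smul_mem' := fun c a ha n hn => by
    rw [← fourierBasis_repr, map_smul, lp.coeFn_smul, Pi.smul_apply, fourierBasis_repr,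
      ha n hn, smul_zero]

theorem continuous_fourierCoeff (n : ℤ) :
    Continuous fun h : L2T => fourierCoeff (h : UnitAddCircle → ℂ) n := by
  have : (fun h : L2T => fourierCoeff (h : UnitAddCircle → ℂ) n)
      = fun h : L2T => inner ℂ (fourierLp 2 n : L2T) h := by
    funext h
    rw [← fourierBasis_repr, fourierBasis.repr_apply_apply, coe_fourierBasis]
  rw [this]
  fun_prop

theorem isClosed_hardy : IsClosed (hardy : Set L2T) := by
  have : (hardy : Set L2T)
      = ⋂ n : ℤ, ⋂ _ : n < 0, {h : L2T | fourierCoeff (h : UnitAddCircle → ℂ) n = 0} := by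
    ext h; simp [hardy]
  rw [this]
  exact isClosed_iInter fun n => isClosed_iInter fun _ =>
    isClosed_eq (continuous_fourierCoeff n) continuous_const

instance : CompleteSpace hardy := isClosed_hardy.completeSpace_coe

/-- `H²₋(𝔻) = L²(𝕋) ⊖ H²(𝔻)`. -/
abbrev hardyMinus : Submodule ℂ L2T := hardyᗮ

theorem fourierCoeff_mulL (k n : ℤ) (h : L2T) :
    fourierCoeff (mulL _ (memLp_fourier k) h : UnitAddCircle → ℂ) n
      = fourierCoeff (h : UnitAddCircle → ℂ) (n - k) := by
  refine integral_congr_ae ?_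
  filter_upwards [mulL_coe _ (memLp_fourier k) h] with x hx
  rw [hx, show -(n - k) = -n + k by ring, fourier_add]
  simp [mul_assoc]

theorem bilateralShift_mem_hardy (h : L2T) (hh : h ∈ hardy) : bilateralShift h ∈ hardy :=
  fun n hn => by
    rw [bilateralShift, fourierCoeff_mulL]
    exact hh _ (by omega)

/-- The unilateral shift `S = U_𝕋|_{H²(𝔻)}`. -/
def shift : hardy →L[ℂ] hardy :=
  (bilateralShift.comp hardy.subtypeL).codRestrict hardy
    fun h => bilateralShift_mem_hardy h h.2

/-- The constant function `𝟏` in `H²(𝔻)`. -/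
def hardyOne : hardy :=
  ⟨fourierLp 2 0, fun n hn => by
    rw [← fourierBasis_repr, fourierBasis.repr_apply_apply, coe_fourierBasis]
    exact orthonormal_fourier.2 hn.ne⟩

/-- The function `χ̄(z) = z̄`, `z ∈ 𝕋`, in `H²₋(𝔻)`. -/
def chiBar : hardyMinus :=
  ⟨fourierLp 2 (-1), (Submodule.mem_orthogonal' _ _).2 fun h hh => by
    have := hh (-1) (by norm_num)
    rwa [← fourierBasis_repr, fourierBasis.repr_apply_apply, coe_fourierBasis] at this⟩

theorem measurePreserving_neg_circle :
    MeasurePreserving (fun x : UnitAddCircle => -x) AddCircle.haarAddCircle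
      AddCircle.haarAddCircle :=
  Measure.measurePreserving_neg _

/-- `(Wh)(z) = z̄ h(z̄)`, as an operator on `L²(𝕋)`. -/
def flipL2 : L2T →L[ℂ] L2T :=
  (mulL _ (memLp_fourier (-1))).comp
    (Lp.compMeasurePreservingₗᵢ ℂ (fun x : UnitAddCircle => -x)
      measurePreserving_neg_circle).toContinuousLinearMap

theorem flipL2_coe (h : L2T) :
    flipL2 h =ᵐ[AddCircle.haarAddCircle] fun x => fourier (-1) x * h (-x) := by
  filter_upwards [mulL_coe _ (memLp_fourier (-1)) (Lp.compMeasurePreservingₗᵢ ℂ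
      (fun x : UnitAddCircle => -x) measurePreserving_neg_circle h),
    Lp.coeFn_compMeasurePreserving h measurePreserving_neg_circle] with x hx hx'
  refine hx.trans ?_
  congr 1

theorem fourierCoeff_flipL2 (h : L2T) (n : ℤ) :
    fourierCoeff (flipL2 h : UnitAddCircle → ℂ) n
      = fourierCoeff (h : UnitAddCircle → ℂ) (-n - 1) := by
  unfold fourierCoeff
  rw [← integral_neg_eq_self (fun t : UnitAddCircle => fourier (-(-n - 1)) t • h t)]
  refine integral_congr_ae ?_
  filter_upwards [flipL2_coe h] with x hx
  have e : (fourier (-(-n - 1)) (-x) : ℂ) = fourier (-n) x * fourier (-1) x := by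
    rw [← fourier_add, fourier_apply, fourier_apply]
    congr 2
    rw [smul_neg, ← neg_smul]
    congr 1
    ring
  rw [hx, e]
  simp [mul_assoc]

theorem flipL2_mem (h : L2T) (hh : h ∈ hardy) : flipL2 h ∈ hardyMinus := by
  rw [Submodule.mem_orthogonal]
  intro g hg
  rw [← fourierBasis.tsum_inner_mul_inner g (flipL2 h)]
  refine (tsum_congr fun n => ?_).trans tsum_zero
  rw [← fourierBasis.repr_apply_apply, fourierBasis_repr, fourierCoeff_flipL2,
    ← inner_conj_symm, ← fourierBasis.repr_apply_apply, fourierBasis_repr]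
  rcases lt_or_ge n 0 with hn | hn
  · rw [hg n hn]; simp
  · rw [hh _ (by omega)]; simp

/-- `W` as an operator from `H²(𝔻)` to `H²₋(𝔻)`. -/
def flipHardy : hardy →L[ℂ] hardyMinus :=
  (flipL2.comp hardy.subtypeL).codRestrict hardyMinus fun h => flipL2_mem h h.2

/-- The value `h(z) = ∑ₙ ĥ(n) zⁿ` of `h ∈ H²(𝔻)` at `z` in the disc. -/
def hardyEval (h : hardy) (z : ℂ) : ℂ :=
  ∑' n : ℕ, fourierCoeff ((h : L2T) : UnitAddCircle → ℂ) n * z ^ n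

/-! ### The operator matrix -/

/-- The operator `T = [[S, (·, X₀^* χ̄) 𝟏], [0, T₀]]` on the Hilbert space direct sum
`H²(𝔻) ⊕ H₀`. -/
def opMatrix {H₀ : Type} [NormedAddCommGroup H₀] [InnerProductSpace ℂ H₀] [CompleteSpace H₀]
    (T₀ : H₀ →L[ℂ] H₀) (X₀ : H₀ →L[ℂ] hardyMinus) :
    WithLp 2 (hardy × H₀) →L[ℂ] WithLp 2 (hardy × H₀) :=
  let e := WithLp.prodContinuousLinearEquiv 2 ℂ hardy H₀
  let coupling : H₀ →L[ℂ] hardy :=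
    (innerSL ℂ (ContinuousLinearMap.adjoint X₀ chiBar)).smulRight hardyOne
  let A : hardy × H₀ →L[ℂ] hardy × H₀ :=
    (shift.coprod coupling).prod (T₀.comp (ContinuousLinearMap.snd ℂ hardy H₀))
  (e.symm : hardy × H₀ →L[ℂ] WithLp 2 (hardy × H₀)).comp
    (A.comp (e : WithLp 2 (hardy × H₀) →L[ℂ] hardy × H₀))

theorem opMatrix_apply {H₀ : Type} [NormedAddCommGroup H₀] [InnerProductSpace ℂ H₀]
    [CompleteSpace H₀] (T₀ : H₀ →L[ℂ] H₀) (X₀ : H₀ →L[ℂ] hardyMinus) (h : hardy) (f : H₀) :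
    opMatrix T₀ X₀ (WithLp.toLp 2 (h, f))
      = WithLp.toLp 2
        (shift h + inner ℂ (ContinuousLinearMap.adjoint X₀ chiBar) f • hardyOne, T₀ f) := by
  simp [opMatrix]

/-! ### The space `P²(ν)` -/

/-- The elements of `L²(ν)` that are given by a polynomial. -/
def polySubmodule (ν : Measure Disc) : Submodule ℂ (Lp ℂ 2 ν) where
  carrier := {f | ∃ p : Polynomial ℂ, f =ᵐ[ν] fun z : Disc => p.eval (z : ℂ)}
  zero_mem' := ⟨0, by filter_upwards [Lp.coeFn_zero ℂ 2 ν] with z hz; exact hz.trans (by simp)⟩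
  add_mem' := by
    rintro a b ⟨p, hp⟩ ⟨q, hq⟩
    refine ⟨p + q, ?_⟩
    filter_upwards [hp, hq, Lp.coeFn_add a b] with z h1 h2 h3
    rw [Polynomial.eval_add, ← h1, ← h2]
    exact h3
  smul_mem' := by
    rintro c a ⟨p, hp⟩
    refine ⟨c • p, ?_⟩
    filter_upwards [hp, Lp.coeFn_smul c a] with z h1 h2
    refine h2.trans ?_
    rw [Pi.smul_apply, h1, Polynomial.eval_smul]

/-- `P²(ν)`, the closure of the polynomials in `L²(ν)`. -/
def P2 (ν : Measure Disc) : Submodule ℂ (Lp ℂ 2 ν) := (polySubmodule ν).topologicalClosure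

instance (ν : Measure Disc) : CompleteSpace (P2 ν) :=
  inferInstanceAs (CompleteSpace (polySubmodule ν).topologicalClosure)

theorem memLp_coord (ν : Measure Disc) : MemLp (fun z : Disc => (z : ℂ)) ∞ ν :=
  memLp_top_of_bound continuous_subtype_val.aestronglyMeasurable 1
    (Eventually.of_forall fun z => (mem_ball_zero_iff.1 z.2).le)

/-- Multiplication by the independent variable on `L²(ν)`. -/
def mulCoord (ν : Measure Disc) : Lp ℂ 2 ν →L[ℂ] Lp ℂ 2 ν := mulL _ (memLp_coord ν)

theorem mulCoord_mem (ν : Measure Disc) (f : Lp ℂ 2 ν) (hf : f ∈ P2 ν) :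
    mulCoord ν f ∈ P2 ν := by
  have h : Set.MapsTo (mulCoord ν) (polySubmodule ν : Set (Lp ℂ 2 ν))
      (polySubmodule ν : Set (Lp ℂ 2 ν)) := by
    rintro g ⟨p, hp⟩
    refine ⟨Polynomial.X * p, ?_⟩
    filter_upwards [hp, mulL_coe _ (memLp_coord ν) g] with z h1 h2
    simp only [mulCoord, h2, h1, Polynomial.eval_mul, Polynomial.eval_X]
  exact h.closure (mulCoord ν).continuous hf

/-- `S_ν`: multiplication by the independent variable on `P²(ν)`. -/
def shiftNu (ν : Measure Disc) : P2 ν →L[ℂ] P2 ν :=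
  ((mulCoord ν).comp (P2 ν).subtypeL).codRestrict (P2 ν) fun f => mulCoord_mem ν f f.2

/-- `P²(ν)` consists of analytic functions in `𝔻` and has bounded point evaluations: every
`f ∈ P²(ν)` is (represented `ν`-a.e. by) a function `E f` analytic in `𝔻`, in such a way that
`E` is linear, `E` sends the class of a polynomial `p` to the function `p` itself, and
for every `w ∈ 𝔻` the map `f ↦ (E f)(w)` is bounded on `P²(ν)`. -/
def AnalyticWithBoundedEvaluations (ν : Measure Disc) : Prop :=
  ∃ E : P2 ν →ₗ[ℂ] (ℂ → ℂ),
    (∀ f : P2 ν, AnalyticOnNhd ℂ (E f) (Metric.ball 0 1)) ∧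
    (∀ f : P2 ν, (f : Lp ℂ 2 ν) =ᵐ[ν] fun z : Disc => E f z) ∧
    (∀ (f : P2 ν) (p : Polynomial ℂ), (f : Lp ℂ 2 ν) =ᵐ[ν] (fun z : Disc => p.eval (z : ℂ)) →
      ∀ z ∈ Metric.ball (0 : ℂ) 1, E f z = p.eval z) ∧
    (∀ w ∈ Metric.ball (0 : ℂ) 1, ∃ C : ℝ, ∀ f : P2 ν, ‖E f w‖ ≤ C * ‖f‖)

/-- The inclusion `H²(𝔻) ⊂ P²(ν)`. -/
def HardySubset (ν : Measure Disc) : Prop :=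
  ∀ h : hardy, ∃ f : P2 ν, (f : Lp ℂ 2 ν) =ᵐ[ν] fun z : Disc => hardyEval h z

/-! ### The natural imbedding `J_ν` -/

theorem norm_fourierCoeff_le (h : L2T) (n : ℤ) :
    ‖fourierCoeff (h : UnitAddCircle → ℂ) n‖ ≤ ‖h‖ := by
  rw [← fourierBasis_repr]
  refine (lp.norm_apply_le_norm (by norm_num) _ n).trans ?_
  simp

theorem norm_hardyTerm_le (h : hardy) (z : Disc) (n : ℕ) :
    ‖fourierCoeff ((h : L2T) : UnitAddCircle → ℂ) n * (z : ℂ) ^ n‖ ≤ ‖h‖ * ‖(z : ℂ)‖ ^ n := by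
  rw [norm_mul, norm_pow]
  exact mul_le_mul_of_nonneg_right (norm_fourierCoeff_le _ _) (by positivity)

theorem summable_bound (c : ℝ) (z : Disc) : Summable fun n : ℕ => c * ‖(z : ℂ)‖ ^ n :=
  (summable_geometric_of_lt_one (norm_nonneg _) (mem_ball_zero_iff.1 z.2)).mul_left c

theorem summable_hardyTerm (h : hardy) (z : Disc) :
    Summable fun n : ℕ => fourierCoeff ((h : L2T) : UnitAddCircle → ℂ) n * (z : ℂ) ^ n :=
  .of_norm_bounded (summable_bound _ z) (norm_hardyTerm_le h z)

theorem hardyEval_add (a b : hardy) (z : Disc) :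
    hardyEval (a + b) z = hardyEval a z + hardyEval b z := by
  unfold hardyEval
  rw [← (summable_hardyTerm a z).tsum_add (summable_hardyTerm b z)]
  refine tsum_congr fun n => ?_
  rw [← fourierBasis_repr, Submodule.coe_add, map_add, lp.coeFn_add, Pi.add_apply,
    fourierBasis_repr, fourierBasis_repr, add_mul]

theorem hardyEval_smul (c : ℂ) (a : hardy) (z : Disc) :
    hardyEval (c • a) z = c * hardyEval a z := by
  unfold hardyEval
  rw [← tsum_mul_left]
  refine tsum_congr fun n => ?_
  rw [← fourierBasis_repr, Submodule.coe_smul, map_smul, lp.coeFn_smul, Pi.smul_apply,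
    fourierBasis_repr, smul_eq_mul, mul_assoc]

theorem continuous_hardyEval (z : Disc) : Continuous fun h : hardy => hardyEval h z := by
  have hl : IsLinearMap ℂ fun h : hardy => hardyEval h z :=
    ⟨fun a b => hardyEval_add a b z, fun c a => hardyEval_smul c a z⟩
  refine AddMonoidHomClass.continuous_of_bound hl.mk' (∑' n : ℕ, 1 * ‖(z : ℂ)‖ ^ n) fun h => ?_
  rw [mul_comm, ← tsum_mul_left]
  refine tsum_of_norm_bounded (((summable_bound 1 z).mul_left ‖h‖).hasSum) fun n => ?_
  rw [one_mul]
  exact norm_hardyTerm_le h z n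

/-- The imbedding of `H²(𝔻)` in `P²(ν)` as a linear map: `h` goes to the class of the function
`z ↦ h(z)` on the disc. -/
def embedLin (ν : Measure Disc) (hν : HardySubset ν) : hardy →ₗ[ℂ] P2 ν where
  toFun h := (hν h).choose
  map_add' a b := by
    apply Subtype.ext
    apply Lp.ext
    rw [Submodule.coe_add]
    filter_upwards [(hν (a + b)).choose_spec, (hν a).choose_spec, (hν b).choose_spec,
      Lp.coeFn_add ((hν a).choose : Lp ℂ 2 ν) (hν b).choose] with z h1 h2 h3 h4
    rw [h1, h4, Pi.add_apply, h2, h3, hardyEval_add]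
  map_smul' c a := by
    apply Subtype.ext
    apply Lp.ext
    rw [RingHom.id_apply, Submodule.coe_smul]
    filter_upwards [(hν (c • a)).choose_spec, (hν a).choose_spec,
      Lp.coeFn_smul c ((hν a).choose : Lp ℂ 2 ν)] with z h1 h2 h4
    rw [h1, h4, Pi.smul_apply, h2, hardyEval_smul, smul_eq_mul]

theorem embedLin_coe (ν : Measure Disc) (hν : HardySubset ν) (h : hardy) :
    (embedLin ν hν h : Lp ℂ 2 ν) =ᵐ[ν] fun z : Disc => hardyEval h z :=
  (hν h).choose_spec

theorem embedLin_closed (ν : Measure Disc) (hν : HardySubset ν) (u : ℕ → hardy) (x : hardy)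
    (y : P2 ν) (hu : Tendsto u atTop (𝓝 x)) (hy : Tendsto (embedLin ν hν ∘ u) atTop (𝓝 y)) :
    y = embedLin ν hν x := by
  have hy' : Tendsto (fun n => (embedLin ν hν (u n) : Lp ℂ 2 ν)) atTop (𝓝 (y : Lp ℂ 2 ν)) :=
    (continuous_subtype_val.tendsto y).comp hy
  obtain ⟨ns, hns, hae⟩ := (tendstoInMeasure_of_tendsto_Lp hy').exists_seq_tendsto_ae
  apply Subtype.ext
  apply Lp.ext
  filter_upwards [hae, embedLin_coe ν hν x,
    ae_all_iff.2 fun n => embedLin_coe ν hν (u n)] with z h1 h2 h3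
  rw [h2]
  refine tendsto_nhds_unique h1 ?_
  simp_rw [h3]
  exact ((continuous_hardyEval z).tendsto x).comp (hu.comp hns.tendsto_atTop)

/-- The natural imbedding `J_ν : H²(𝔻) → P²(ν)`; it is bounded by the closed graph theorem. -/
def embed (ν : Measure Disc) (hν : HardySubset ν) : hardy →L[ℂ] P2 ν :=
  ContinuousLinearMap.ofSeqClosedGraph (g := embedLin ν hν)
    fun u x y => embedLin_closed ν hν u x y

/-- `X₀ = W J_ν^*`, an operator from `P²(ν)` to `H²₋(𝔻)`. -/
def couplingX (ν : Measure Disc) (hν : HardySubset ν) : P2 ν →L[ℂ] hardyMinus :=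
  flipHardy.comp (ContinuousLinearMap.adjoint (embed ν hν))

/-- The operator `T` on `H²(𝔻) ⊕ P²(ν)` with `T₀ = S_ν^*` and `X₀ = W J_ν^*`. -/
def opT (ν : Measure Disc) (hν : HardySubset ν) :
    WithLp 2 (hardy × P2 ν) →L[ℂ] WithLp 2 (hardy × P2 ν) :=
  opMatrix (ContinuousLinearMap.adjoint (shiftNu ν)) (couplingX ν hν)

end QuasiHardy

end

namespace QuasiHardy

/-! ### Multiplication operators and the shift on the Hardy space -/

/-! The matrix is upper triangular with contractive diagonal entries, so for `‖z‖ > 1` the operator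
`T - z` is inverted by back substitution. For `‖z‖ = 1` the approximate eigenvectors of `S`, placed
in the first summand, rule out a bounded inverse.

The substance is the open disc, where neither diagonal entry of `T - z` need be invertible and the
coupling must compensate. There `(h, c) ↦ (S - z)h + c𝟏` is a bijection from `H² × ℂ` onto `H²`: for
`z = 0` this is removal of the constant term, and the general case follows by applying the
invertible operator `1 - zS^*`. Hence it is enough that `f ↦ ((S_ν^* - z)f, (f, u))` is a bijection
onto `P²(ν) × ℂ`, where `u = X₀^*χ̄ = J_ν𝟏` is the constant function `1`
(`adjoint_couplingX_chiBar`).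

This map is the adjoint of `(g, c) ↦ (S_ν - a)g + cu` with `a = z̄`, so it remains to see that every
`f` in `P²(ν)` is uniquely `f(a) + (z - a)g`. For polynomials this is division by `z - a`. It passes
to the closure because `S_ν - a` is bounded below (`shiftNu_sub_bounded_below`), by the maximum
principle and the uniform boundedness of point evaluations on a circle around `a`. -/

theorem mulL_sub_smul_apply {α : Type} [MeasurableSpace α] {μ : Measure α} (g : α → ℂ)
    (hg : MemLp g ∞ μ) (c : ℂ) (f : Lp ℂ 2 μ) :
    (mulL g hg f - c • f : Lp ℂ 2 μ) =ᵐ[μ] fun x => (g x - c) * f x := by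
  filter_upwards [mulL_coe g hg f, Lp.coeFn_sub (mulL g hg f) (c • f), Lp.coeFn_smul c f]
    with x h1 h2 h3
  rw [h2, Pi.sub_apply, h1, h3, Pi.smul_apply, smul_eq_mul, sub_mul]

theorem norm_mulL_fourier (k : ℤ) (h : L2T) : ‖mulL _ (memLp_fourier k) h‖ = ‖h‖ := by
  rw [Lp.norm_def, Lp.norm_def]
  congr 1
  refine eLpNorm_congr_norm_ae ?_
  filter_upwards [mulL_coe _ (memLp_fourier k) h] with x hx
  rw [hx, norm_mul, fourier_apply, Circle.norm_coe, one_mul]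

theorem norm_shift_apply (h : hardy) : ‖shift h‖ = ‖h‖ :=
  norm_mulL_fourier 1 (h : L2T)

theorem norm_shift_le : ‖shift‖ ≤ 1 :=
  shift.opNorm_le_bound zero_le_one fun h => by rw [norm_shift_apply, one_mul]

theorem adjoint_shift_shift (h : hardy) : ContinuousLinearMap.adjoint shift (shift h) = h :=
  DFunLike.congr_fun
    ((ContinuousLinearMap.norm_map_iff_adjoint_comp_self shift).1 norm_shift_apply) h

theorem inner_hardyOne (h : hardy) :
    inner ℂ hardyOne h = fourierCoeff ((h : L2T) : UnitAddCircle → ℂ) 0 := by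
  rw [← fourierBasis_repr, fourierBasis.repr_apply_apply, coe_fourierBasis]
  rfl

theorem inner_hardyOne_shift (h : hardy) : inner ℂ hardyOne (shift h) = 0 := by
  rw [inner_hardyOne]
  refine (fourierCoeff_mulL 1 0 (h : L2T)).trans ?_
  exact h.2 _ (by norm_num)

theorem norm_hardyOne : ‖hardyOne‖ = 1 :=
  orthonormal_fourier.1 0

theorem inner_hardyOne_self : inner ℂ hardyOne hardyOne = (1 : ℂ) := by
  rw [inner_self_eq_norm_sq_to_K (𝕜 := ℂ) hardyOne, norm_hardyOne]
  norm_num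

theorem adjoint_shift_hardyOne : ContinuousLinearMap.adjoint shift hardyOne = 0 := by
  refine ext_inner_right ℂ fun h => ?_
  rw [ContinuousLinearMap.adjoint_inner_left, inner_hardyOne_shift, inner_zero_left]

/-- Take `c = ĝ(0)` and multiply `g - c𝟏` by `z̄`. -/
theorem exists_shift_add_smul_hardyOne (g : hardy) :
    ∃ (h : hardy) (c : ℂ), shift h + c • hardyOne = g := by
  set c : ℂ := inner ℂ hardyOne g
  have hmem : mulL _ (memLp_fourier (-1)) ((g - c • hardyOne : hardy) : L2T) ∈ hardy := by
    intro n hn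
    rw [fourierCoeff_mulL]
    rcases lt_or_ge (n - -1) 0 with h | h
    · exact (g - c • hardyOne).2 _ h
    -- Only the index `-1` could spoil membership in `H²`; its coefficient is the zeroth one of `g -
    -- c𝟏`, which vanishes by the choice of `c`.
    · obtain rfl : n = -1 := by omega
      rw [sub_self, ← inner_hardyOne, inner_sub_right, inner_smul_right (𝕜 := ℂ) hardyOne hardyOne,
        inner_hardyOne_self, mul_one, sub_self]
  refine ⟨⟨_, hmem⟩, c, ?_⟩
  rw [← eq_sub_iff_add_eq]
  apply Subtype.ext
  apply Lp.ext
  filter_upwards [mulL_coe _ (memLp_fourier 1)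
      (mulL _ (memLp_fourier (-1)) ((g - c • hardyOne : hardy) : L2T)),
    mulL_coe _ (memLp_fourier (-1)) ((g - c • hardyOne : hardy) : L2T)] with x h1 h2
  refine h1.trans ?_
  rw [h2, ← mul_assoc, ← fourier_add]
  simp

/-- `S - z = (1 - z S^*) S`. -/
theorem shift_sub_smul_add (z : ℂ) (h : hardy) (c : ℂ) :
    shift h - z • h + c • hardyOne
      = (1 - z • ContinuousLinearMap.adjoint shift) (shift h + c • hardyOne) := by
  simp [adjoint_shift_shift, adjoint_shift_hardyOne]
  abel

theorem bijective_one_sub_smul_adjoint_shift {z : ℂ} (hz : ‖z‖ < 1) :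
    Function.Bijective (1 - z • ContinuousLinearMap.adjoint shift : hardy →L[ℂ] hardy) := by
  rw [← ContinuousLinearMap.isUnit_iff_bijective]
  refine isUnit_one_sub_of_norm_lt_one (R := hardy →L[ℂ] hardy) ?_
  refine (ContinuousLinearMap.opNorm_smul_le z (ContinuousLinearMap.adjoint shift)).trans_lt ?_
  rw [LinearIsometryEquiv.norm_map]
  exact (mul_le_of_le_one_right (norm_nonneg _) norm_shift_le).trans_lt hz

/-- The invertible operator `1 - zS^*` carries the decomposition at `0` to the one at `z`: it fixes
`𝟏`, since `S^*𝟏 = 0`, and turns `S` into `S - z`. -/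
theorem exists_shift_sub_smul_add {z : ℂ} (hz : ‖z‖ < 1) (g : hardy) :
    ∃ (h : hardy) (c : ℂ), shift h - z • h + c • hardyOne = g := by
  obtain ⟨g', rfl⟩ := (bijective_one_sub_smul_adjoint_shift hz).2 g
  obtain ⟨h, c, rfl⟩ := exists_shift_add_smul_hardyOne g'
  exact ⟨h, c, shift_sub_smul_add z h c⟩

theorem eq_zero_of_shift_sub_smul_add {z : ℂ} (hz : ‖z‖ < 1) {h : hardy} {c : ℂ}
    (H : shift h - z • h + c • hardyOne = 0) : h = 0 ∧ c = 0 := by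
  rw [shift_sub_smul_add] at H
  have H' : shift h + c • hardyOne = 0 :=
    (bijective_one_sub_smul_adjoint_shift hz).1 (H.trans (map_zero _).symm)
  -- `S^*` inverts `S` and kills `𝟏`, which isolates `h`; pairing with `𝟏`, which is orthogonal to
  -- the range of `S`, isolates `c`.
  constructor
  · have := congrArg (ContinuousLinearMap.adjoint shift) H'
    simpa [adjoint_shift_shift, adjoint_shift_hardyOne] using this
  · have := congrArg (inner ℂ hardyOne) H'
    rwa [inner_add_right, inner_smul_right (𝕜 := ℂ) hardyOne hardyOne, inner_hardyOne_shift, inner_hardyOne_self,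
      inner_zero_right, mul_one, zero_add] at this

theorem shift_pow_hardyOne (n : ℕ) : (((shift ^ n) hardyOne : hardy) : L2T) = fourierLp 2 n := by
  induction n with
  | zero => rfl
  | succ n ih =>
    rw [pow_succ', mul_apply_eq_comp]
    apply Lp.ext
    filter_upwards [mulL_coe _ (memLp_fourier 1) (((shift ^ n) hardyOne : hardy) : L2T),
      coeFn_fourierLp (T := 1) 2 (n : ℤ),
      coeFn_fourierLp (T := 1) 2 ((n + 1 : ℕ) : ℤ)] with x h1 h2 h3
    refine h1.trans ?_
    rw [ih, h2, h3, ← fourier_add, add_comm, Nat.cast_succ]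

theorem orthonormal_shift_pow_hardyOne :
    Orthonormal ℂ fun n : ℕ => (shift ^ n) hardyOne := by
  have h : Orthonormal ℂ fun n : ℕ => (fourierLp 2 (n : ℤ) : L2T) :=
    (orthonormal_fourier (T := 1)).comp _ Nat.cast_injective
  refine ⟨fun n => ?_, fun m n hmn => ?_⟩
  · refine (congrArg norm (shift_pow_hardyOne n)).trans ?_
    exact h.1 n
  · refine (congrArg₂ (inner ℂ) (shift_pow_hardyOne m) (shift_pow_hardyOne n)).trans ?_
    exact h.2 hmn

/-- The points of the circle are approximate eigenvalues of the shift. -/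
theorem not_bounded_below_shift_sub {z : ℂ} (hz : ‖z‖ = 1) (C : ℝ) :
    ∃ h : hardy, C * ‖shift h - z • h‖ < ‖h‖ := by
  by_contra! H
  have key (n : ℕ) : (n : ℝ) ≤ (|C| * 2) ^ 2 := by
    -- The coefficients are unimodular, so `‖h‖ = √n`, while `(S - z)h` telescopes to `χⁿ - zⁿ𝟏`, of
    -- norm at most `2`. A lower bound for `S - z` would therefore bound `n`.
    set h : hardy := ∑ i ∈ Finset.range n, z ^ (n - 1 - i) • (shift ^ i) hardyOne with hh
    have hn : ‖h‖ ^ 2 = n := by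
      have := orthonormal_shift_pow_hardyOne.inner_sum (fun i => z ^ (n - 1 - i))
        (fun i => z ^ (n - 1 - i)) (Finset.range n)
      simp only [← hh, RCLike.conj_mul, norm_pow, hz, one_pow] at this
      rw [inner_self_eq_norm_sq_to_K] at this
      have h2 : ((‖h‖ ^ 2 : ℝ) : ℂ) = (n : ℝ) := by simpa using this
      exact_mod_cast h2
    have htel : shift h - z • h = (shift ^ n) hardyOne - z ^ n • hardyOne := by
      have hsum : (∑ i ∈ Finset.range n, shift ^ i *
          algebraMap ℂ (hardy →L[ℂ] hardy) z ^ (n - 1 - i)) hardyOne = h := by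
        rw [sum_apply]
        refine Finset.sum_congr rfl fun i _ => ?_
        rw [← map_pow, ← Algebra.commutes, ← Algebra.smul_def, smul_apply]
      have := DFunLike.congr_fun
        (Commute.mul_geom_sum₂ (Algebra.commutes z shift).symm n) hardyOne
      rw [mul_apply_eq_comp, hsum, ← map_pow] at this
      simpa only [Algebra.algebraMap_eq_smul_one, sub_apply, smul_apply, one_apply_eq_self]
        using this
    have hle : ‖shift h - z • h‖ ≤ 2 := by
      rw [htel]
      refine (norm_sub_le _ _).trans ?_
      rw [orthonormal_shift_pow_hardyOne.1 n, norm_smul, norm_pow, hz, one_pow, norm_hardyOne]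
      norm_num
    rw [← hn]
    refine pow_le_pow_left₀ (norm_nonneg _) ((H h).trans ?_) 2
    exact mul_le_mul (le_abs_self C) hle (norm_nonneg _) (abs_nonneg C)
  obtain ⟨n, hn⟩ := exists_nat_gt ((|C| * 2) ^ 2)
  exact (key n).not_gt hn

/-! ### The operator matrix -/

section Matrix

variable {H₀ : Type} [NormedAddCommGroup H₀] [InnerProductSpace ℂ H₀] [CompleteSpace H₀]
  (T₀ : H₀ →L[ℂ] H₀) (X₀ : H₀ →L[ℂ] hardyMinus)

theorem notMem_spectrum_opMatrix {z : ℂ}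
    (hinj : ∀ (h : hardy) (f : H₀),
      shift h - z • h + inner ℂ (ContinuousLinearMap.adjoint X₀ chiBar) f • hardyOne = 0 →
        T₀ f - z • f = 0 → h = 0 ∧ f = 0)
    (hsurj : ∀ (g : hardy) (k : H₀), ∃ (h : hardy) (f : H₀),
      shift h - z • h + inner ℂ (ContinuousLinearMap.adjoint X₀ chiBar) f • hardyOne = g ∧
        T₀ f - z • f = k) :
    z ∉ spectrum ℂ (opMatrix T₀ X₀) := by
  rw [spectrum.notMem_iff, ← IsUnit.neg_iff, neg_sub, ContinuousLinearMap.isUnit_iff_bijective]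
  have happ (h : hardy) (f : H₀) :
      (opMatrix T₀ X₀ - algebraMap ℂ _ z) (WithLp.toLp 2 (h, f)) = WithLp.toLp 2
        (shift h - z • h + inner ℂ (ContinuousLinearMap.adjoint X₀ chiBar) f • hardyOne,
          T₀ f - z • f) := by
    rw [sub_apply, opMatrix_apply, Algebra.algebraMap_eq_smul_one,
      smul_apply, one_apply_eq_self, ← WithLp.toLp_smul,
      ← WithLp.toLp_sub, Prod.smul_mk, Prod.mk_sub_mk, sub_add_eq_add_sub]
  constructor
  · rw [injective_iff_map_eq_zero]
    rintro ⟨h, f⟩ H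
    rw [happ, WithLp.toLp_eq_zero, Prod.mk_eq_zero] at H
    obtain ⟨rfl, rfl⟩ := hinj h f H.1 H.2
    rfl
  · rintro ⟨g, k⟩
    obtain ⟨h, f, rfl, rfl⟩ := hsurj g k
    exact ⟨_, happ h f⟩

theorem norm_le_one_of_mem_spectrum_opMatrix (hT : ‖T₀‖ ≤ 1) {z : ℂ}
    (hz : z ∈ spectrum ℂ (opMatrix T₀ X₀)) : ‖z‖ ≤ 1 := by
  by_contra! hlt
  have hbij {E : Type} [NormedAddCommGroup E] [NormedSpace ℂ E] [CompleteSpace E]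
      (A : E →L[ℂ] E) (hA : ‖A‖ ≤ 1) : Function.Bijective (A - algebraMap ℂ (E →L[ℂ] E) z) := by
    rw [← ContinuousLinearMap.isUnit_iff_bijective, ← IsUnit.neg_iff, neg_sub]
    refine spectrum.mem_resolventSet_of_norm_lt_mul (lt_of_le_of_lt ?_ hlt)
    exact mul_le_one₀ hA (norm_nonneg _) ContinuousLinearMap.norm_id_le
  have h₁ := hbij shift norm_shift_le
  have h₂ := hbij T₀ hT
  refine notMem_spectrum_opMatrix T₀ X₀ (fun h f hh hf => ?_) (fun g k => ?_) hz
  · obtain rfl : f = 0 := (injective_iff_map_eq_zero _).1 h₂.1 f hf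
    rw [inner_zero_right, zero_smul, add_zero] at hh
    exact ⟨(injective_iff_map_eq_zero _).1 h₁.1 h hh, rfl⟩
  · obtain ⟨f, hf⟩ := h₂.2 k
    obtain ⟨h, hh⟩ := h₁.2 (g - inner ℂ (ContinuousLinearMap.adjoint X₀ chiBar) f • hardyOne)
    exact ⟨h, f, eq_sub_iff_add_eq.1 hh, hf⟩

/-- On the first summand the matrix acts as `S`, so an inverse of `T - z` would make `S - z` bounded
below. -/
theorem mem_spectrum_opMatrix_of_norm_eq_one {z : ℂ} (hz : ‖z‖ = 1) :
    z ∈ spectrum ℂ (opMatrix T₀ X₀) := by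
  rw [spectrum.mem_iff, ← IsUnit.neg_iff, neg_sub]
  rintro ⟨u, hu⟩
  obtain ⟨h, hh⟩ := not_bounded_below_shift_sub hz ‖(↑u⁻¹ : WithLp 2 (hardy × H₀) →L[ℂ] WithLp 2 (hardy × H₀))‖
  refine hh.not_ge ?_
  have happ : (u : WithLp 2 (hardy × H₀) →L[ℂ] WithLp 2 (hardy × H₀)) (WithLp.toLp 2 (h, 0))
      = WithLp.toLp 2 (shift h - z • h, 0) := by
    rw [hu, sub_apply, opMatrix_apply, Algebra.algebraMap_eq_smul_one,
      smul_apply, one_apply_eq_self, ← WithLp.toLp_smul,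
      ← WithLp.toLp_sub, Prod.smul_mk, Prod.mk_sub_mk]
    simp
  have hinv := congrArg (↑u⁻¹ : WithLp 2 (hardy × H₀) →L[ℂ] WithLp 2 (hardy × H₀)) happ
  rw [← mul_apply_eq_comp, Units.inv_mul, one_apply_eq_self] at hinv
  have := (↑u⁻¹ : WithLp 2 (hardy × H₀) →L[ℂ] WithLp 2 (hardy × H₀)).le_opNorm (WithLp.toLp 2 (shift h - z • h, 0))
  rwa [← hinv, WithLp.norm_toLp_fst, WithLp.norm_toLp_fst] at this

/-- If `f ↦ (T₀ f - z f, (f, u))` is bijective onto `H₀ × ℂ`, where `u = X₀^* χ̄`, then `z` is in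
the resolvent set of the operator matrix. -/
theorem notMem_spectrum_opMatrix_of_norm_lt_one {z : ℂ} (hz : ‖z‖ < 1)
    (hinj : ∀ f : H₀, T₀ f - z • f = 0 →
      inner ℂ (ContinuousLinearMap.adjoint X₀ chiBar) f = 0 → f = 0)
    (hsurj : ∀ (k : H₀) (c : ℂ), ∃ f : H₀, T₀ f - z • f = k ∧
      inner ℂ (ContinuousLinearMap.adjoint X₀ chiBar) f = c) :
    z ∉ spectrum ℂ (opMatrix T₀ X₀) := by
  refine notMem_spectrum_opMatrix T₀ X₀ (fun h f hh hf => ?_) (fun g k => ?_)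
  · obtain ⟨h0, h1⟩ := eq_zero_of_shift_sub_smul_add hz hh
    exact ⟨h0, hinj f hf h1⟩
  -- The range of `S - z` misses one dimension; the scalar `c` needed to reach `g` is then
  -- prescribed as the value of `(f, u)`.
  · obtain ⟨h, c, hh⟩ := exists_shift_sub_smul_add hz g
    obtain ⟨f, hf, rfl⟩ := hsurj k c
    exact ⟨h, f, hh, hf⟩

end Matrix

/-! ### Duality for an operator bordered by one vector -/

section Duality

variable {K : Type} [NormedAddCommGroup K] [InnerProductSpace ℂ K] [CompleteSpace K]

/-- The assumptions on `f` make it orthogonal to the range of `A - w` and to `u`, which together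
span `K`. -/
theorem eq_zero_of_adjoint_sub_smul {A : K →L[ℂ] K} {u : K} {w : ℂ}
    (hsurj : ∀ f : K, ∃ (g : K) (c : ℂ), A g - w • g + c • u = f) {f : K}
    (hf : ContinuousLinearMap.adjoint A f - (starRingEnd ℂ) w • f = 0) (hu : inner ℂ u f = 0) :
    f = 0 := by
  refine ext_inner_right ℂ fun x => ?_
  obtain ⟨g, c, rfl⟩ := hsurj x
  have h1 : inner ℂ f (A g - w • g) = 0 := by
    rw [inner_sub_right, inner_smul_right, ← ContinuousLinearMap.adjoint_inner_left]
    have := congrArg (fun y => inner ℂ y g) hf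
    simpa [inner_sub_left, inner_smul_left, mul_comm] using this
  rw [inner_add_right, h1, inner_smul_right, inner_eq_zero_symm.1 hu, mul_zero, add_zero,
    inner_zero_left]

/-- The two equations for `f` prescribe the functional `(f, ·)` on the range of `A - w` and on `u`.
Since `(g, d) ↦ (A - w)g + du` has a bounded inverse, by the open mapping theorem, this defines a
bounded functional, and `f` is its Riesz representative. -/
theorem exists_adjoint_sub_smul {A : K →L[ℂ] K} {u : K} {w : ℂ}
    (hinj : ∀ (g : K) (c : ℂ), A g - w • g + c • u = 0 → g = 0 ∧ c = 0)
    (hsurj : ∀ f : K, ∃ (g : K) (c : ℂ), A g - w • g + c • u = f) (k : K) (c : ℂ) :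
    ∃ f : K, ContinuousLinearMap.adjoint A f - (starRingEnd ℂ) w • f = k ∧ inner ℂ u f = c := by
  let V : K × ℂ →L[ℂ] K :=
    (A - w • (1 : K →L[ℂ] K)).coprod ((ContinuousLinearMap.id ℂ ℂ).smulRight u)
  have hV (g : K) (c : ℂ) : V (g, c) = A g - w • g + c • u := by simp [V]
  let e : (K × ℂ) ≃L[ℂ] K := .ofBijective V
    (LinearMap.ker_eq_bot'.2 fun ⟨g, c⟩ h => by
      obtain ⟨rfl, rfl⟩ := hinj g c ((hV g c).symm.trans h)
      rfl)
    (LinearMap.range_eq_top.2 fun f => by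
      obtain ⟨g, c, h⟩ := hsurj f
      exact ⟨(g, c), (hV g c).trans h⟩)
  have he (g : K) (c : ℂ) : e.symm (A g - w • g + c • u) = (g, c) := by
    rw [← hV]
    exact e.symm_apply_apply _
  -- The conjugate of `c` appears because `φ u` is `inner ℂ f u`, the conjugate of `inner ℂ u f`.
  let φ : K →L[ℂ] ℂ := (innerSL ℂ k).comp ((ContinuousLinearMap.fst ℂ K ℂ).comp (e.symm : K →L[ℂ] K × ℂ))
    + (starRingEnd ℂ) c • (ContinuousLinearMap.snd ℂ K ℂ).comp (e.symm : K →L[ℂ] K × ℂ)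
  have hφ (g : K) (d : ℂ) :
      φ (A g - w • g + d • u) = inner ℂ k g + (starRingEnd ℂ) c * d := by
    simp only [φ, add_apply, smul_apply,
      ContinuousLinearMap.comp_apply, ContinuousLinearEquiv.coe_coe, he]
    simp
  refine ⟨(InnerProductSpace.toDual ℂ K).symm φ, ?_, ?_⟩
  · refine ext_inner_right ℂ fun g => ?_
    have := hφ g 0
    rw [zero_smul, add_zero, mul_zero, add_zero] at this
    rw [inner_sub_left, ContinuousLinearMap.adjoint_inner_left, inner_smul_left,
      Complex.conj_conj, ← inner_smul_right, ← inner_sub_right,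
      InnerProductSpace.toDual_symm_apply, this]
  · have := hφ 0 1
    rw [map_zero, smul_zero, sub_zero, zero_add, one_smul, inner_zero_right, zero_add,
      mul_one] at this
    rw [← inner_conj_symm, InnerProductSpace.toDual_symm_apply, this, Complex.conj_conj]

end Duality

/-! ### The space `P²(ν)` -/

section NuSpace

variable (ν : Measure Disc)

theorem norm_shiftNu_le : ‖shiftNu ν‖ ≤ 1 := by
  refine (shiftNu ν).opNorm_le_bound zero_le_one fun f => ?_
  refine Lp.norm_le_mul_norm_of_ae_le_mul ?_
  filter_upwards [mulL_coe _ (memLp_coord ν) (f : Lp ℂ 2 ν)] with z hz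
  refine (congrArg norm hz).trans_le ?_
  rw [norm_mul]
  exact mul_le_mul_of_nonneg_right (mem_ball_zero_iff.1 z.2).le (norm_nonneg _)

theorem shiftNu_coe (f : P2 ν) :
    (shiftNu ν f : Lp ℂ 2 ν) =ᵐ[ν] fun z : Disc => (z : ℂ) * (f : Lp ℂ 2 ν) z :=
  mulL_coe _ (memLp_coord ν) (f : Lp ℂ 2 ν)

/-- A closed condition on `P²(ν)` holds everywhere if it holds for the polynomials. -/
theorem P2_induction {P : P2 ν → Prop} (hclosed : IsClosed {f | P f})
    (hpoly : ∀ (f : P2 ν) (p : Polynomial ℂ),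
      (f : Lp ℂ 2 ν) =ᵐ[ν] (fun z : Disc => p.eval (z : ℂ)) → P f) (f : P2 ν) : P f := by
  have hd : DenseRange (Set.inclusion (polySubmodule ν).le_topologicalClosure) :=
    (denseRange_inclusion_iff (s := (polySubmodule ν : Set (Lp ℂ 2 ν)))
      (t := ((polySubmodule ν).topologicalClosure : Set (Lp ℂ 2 ν))) _).2 subset_rfl
  refine isClosed_property hd hclosed (fun g => ?_) f
  obtain ⟨p, hp⟩ := g.2
  exact hpoly _ p hp

variable [IsFiniteMeasure ν]

/-- Every polynomial represents an element of `P²(ν)`. -/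
theorem exists_P2_polynomial (p : Polynomial ℂ) :
    ∃ f : P2 ν, (f : Lp ℂ 2 ν) =ᵐ[ν] fun z : Disc => p.eval (z : ℂ) := by
  have hc : Continuous fun z : ℂ => p.eval z := p.continuous
  obtain ⟨C, hC⟩ := (isCompact_closedBall (0 : ℂ) 1).exists_bound_of_continuousOn hc.continuousOn
  have hm : MemLp (fun z : Disc => p.eval (z : ℂ)) 2 ν :=
    MemLp.of_bound (hc.comp continuous_subtype_val).aestronglyMeasurable C
      (Eventually.of_forall fun z => hC z (Metric.ball_subset_closedBall z.2))
  exact ⟨⟨hm.toLp, (polySubmodule ν).le_topologicalClosure ⟨p, hm.coeFn_toLp⟩⟩, hm.coeFn_toLp⟩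

/-- Minkowski's inequality; finiteness of `ν` puts the constant `b` in `L²(ν)`. -/
theorem norm_le_of_ae_le_mul_add {f g : Lp ℂ 2 ν} {a b : ℝ} (ha : 0 ≤ a) (hb : 0 ≤ b)
    (h : ∀ᵐ z ∂ν, ‖f z‖ ≤ a * ‖g z‖ + b) :
    ‖f‖ ≤ a * ‖g‖ + b * ν.real Set.univ ^ (1 / (2 : ℝ≥0∞).toReal) := by
  have hg := (Lp.memLp g).norm
  calc ‖f‖ ≤ ‖a • hg.toLp + Lp.const 2 ν b‖ := by
        refine Lp.norm_le_norm_of_ae_le ?_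
        filter_upwards [h, Lp.coeFn_add (a • hg.toLp) (Lp.const 2 ν b),
          Lp.coeFn_smul a hg.toLp, hg.coeFn_toLp, Lp.coeFn_const 2 ν b] with z h0 h1 h2 h3 h4
        rw [h1, Pi.add_apply, h2, Pi.smul_apply, h3, h4, smul_eq_mul]
        exact h0.trans (le_abs_self _)
    _ ≤ ‖a • hg.toLp‖ + ‖Lp.const 2 ν b‖ := norm_add_le _ _
    _ ≤ _ := by
        refine add_le_add ?_ ((Lp.norm_const_le 2 ν b).trans_eq ?_)
        · rw [norm_smul, Real.norm_of_nonneg ha, Lp.norm_toLp, eLpNorm_norm, Lp.norm_def]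
        · rw [Real.norm_of_nonneg hb]

end NuSpace

/-- If `‖(w - a) f(w)‖ ≤ M` on the circle `‖w - a‖ = r`, then `f` is dominated by
`‖(z - a) f(z)‖` (outside the circle) and by `M` (inside it, by the maximum principle). -/
theorem norm_le_of_sphere_bound {f : ℂ → ℂ} {a : ℂ} {r M : ℝ} (hr : 0 < r)
    (hf : AnalyticOnNhd ℂ f (Metric.ball 0 1)) (hsub : Metric.closedBall a r ⊆ Metric.ball 0 1)
    (hM : ∀ w ∈ Metric.sphere a r, ‖(w - a) * f w‖ ≤ M) (z : ℂ) :
    ‖f z‖ ≤ r⁻¹ * ‖(z - a) * f z‖ + r⁻¹ * M := by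
  have hM0 : 0 ≤ M := by
    obtain ⟨w, hw⟩ : (Metric.sphere a r).Nonempty := NormedSpace.sphere_nonempty.2 hr.le
    exact (norm_nonneg _).trans (hM w hw)
  rcases le_or_gt r ‖z - a‖ with hz | hz
  · refine le_add_of_le_of_nonneg ?_ (by positivity)
    rw [norm_mul, ← mul_assoc]
    refine le_mul_of_one_le_left (norm_nonneg _) ?_
    rwa [inv_mul_eq_div, one_le_div hr]
  · refine le_add_of_nonneg_of_le (by positivity) ?_
    refine Complex.norm_le_of_forall_mem_frontier_norm_le (U := Metric.ball a r)
      Metric.isBounded_ball (hf.differentiableOn.diffContOnCl_ball hsub) (fun w hw => ?_)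
      (subset_closure (mem_ball_iff_norm.2 hz))
    rw [frontier_ball a hr.ne'] at hw
    have := hM w hw
    rwa [norm_mul, mem_sphere_iff_norm.1 hw, ← le_inv_mul_iff₀ hr] at this

/-! ### Division by `z - a` in `P²(ν)` -/

section Evaluation

variable {ν : Measure Disc} {E : P2 ν →ₗ[ℂ] (ℂ → ℂ)}

theorem continuous_eval_of_bound {w : ℂ} (hb : ∃ C : ℝ, ∀ f : P2 ν, ‖E f w‖ ≤ C * ‖f‖) :
    Continuous fun f => E f w := by
  obtain ⟨C, hC⟩ := hb
  exact AddMonoidHomClass.continuous_of_bound ((LinearMap.proj w).comp E) C hC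

/-- The almost everywhere identity says nothing at a single point `w`, so the formula is checked on
polynomials and extended by density and continuity of the evaluation. -/
theorem eval_shiftNu
    (hpoly : ∀ (f : P2 ν) (p : Polynomial ℂ),
      (f : Lp ℂ 2 ν) =ᵐ[ν] (fun z : Disc => p.eval (z : ℂ)) →
        ∀ z ∈ Metric.ball (0 : ℂ) 1, E f z = p.eval z)
    (hbdd : ∀ w ∈ Metric.ball (0 : ℂ) 1, ∃ C : ℝ, ∀ f : P2 ν, ‖E f w‖ ≤ C * ‖f‖)
    {w : ℂ} (hw : w ∈ Metric.ball (0 : ℂ) 1) (f : P2 ν) :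
    E (shiftNu ν f) w = w * E f w := by
  have hc := continuous_eval_of_bound (hbdd w hw)
  refine P2_induction ν (P := fun f => E (shiftNu ν f) w = w * E f w)
    (isClosed_eq (hc.comp (shiftNu ν).continuous) (continuous_const.mul hc)) (fun g p hp => ?_) f
  rw [hpoly g p hp w hw, hpoly (shiftNu ν g) (Polynomial.X * p) _ w hw]
  · simp
  · filter_upwards [hp, shiftNu_coe ν g] with z h1 h2
    rw [h2, h1, Polynomial.eval_mul, Polynomial.eval_X]

/-- Point evaluations are uniformly bounded on compact sets. -/
theorem exists_uniform_bound_eval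
    (hE : ∀ f : P2 ν, AnalyticOnNhd ℂ (E f) (Metric.ball 0 1))
    (hbdd : ∀ w ∈ Metric.ball (0 : ℂ) 1, ∃ C : ℝ, ∀ f : P2 ν, ‖E f w‖ ≤ C * ‖f‖)
    {K : Set ℂ} (hK : IsCompact K) (hsub : K ⊆ Metric.ball 0 1) :
    ∃ C : ℝ, ∀ w ∈ K, ∀ f : P2 ν, ‖E f w‖ ≤ C * ‖f‖ := by
  let ev (w : K) : P2 ν →L[ℂ] ℂ :=
    ⟨(LinearMap.proj (w : ℂ)).comp E, continuous_eval_of_bound (hbdd w (hsub w.2))⟩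
  -- For each fixed `f` the evaluations at points of `K` are bounded, since `E f` is continuous on
  -- the compact set `K`.
  obtain ⟨C, hC⟩ := banach_steinhaus (g := ev) fun f => by
    obtain ⟨C, hC⟩ := hK.exists_bound_of_continuousOn ((hE f).continuousOn.mono hsub)
    exact ⟨C, fun w => hC w w.2⟩
  exact ⟨C, fun w hw f => (ev ⟨w, hw⟩).le_of_opNorm_le (hC ⟨w, hw⟩) f⟩

variable [IsFiniteMeasure ν]

/-- Put `g = (S_ν - a)f`. On a small circle around `a` the values of `g` are at most a constant
times `‖g‖`, so `norm_le_of_sphere_bound` controls `f` at every point of the disc by `g` and `‖g‖`;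
then take `L²(ν)` norms. -/
theorem shiftNu_sub_bounded_below
    (hE : ∀ f : P2 ν, AnalyticOnNhd ℂ (E f) (Metric.ball 0 1))
    (hae : ∀ f : P2 ν, (f : Lp ℂ 2 ν) =ᵐ[ν] fun z : Disc => E f z)
    (hpoly : ∀ (f : P2 ν) (p : Polynomial ℂ),
      (f : Lp ℂ 2 ν) =ᵐ[ν] (fun z : Disc => p.eval (z : ℂ)) →
        ∀ z ∈ Metric.ball (0 : ℂ) 1, E f z = p.eval z)
    (hbdd : ∀ w ∈ Metric.ball (0 : ℂ) 1, ∃ C : ℝ, ∀ f : P2 ν, ‖E f w‖ ≤ C * ‖f‖)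
    {a : ℂ} (ha : ‖a‖ < 1) : ∃ C : ℝ, ∀ f : P2 ν, ‖f‖ ≤ C * ‖shiftNu ν f - a • f‖ := by
  obtain ⟨r, hr, hsub⟩ := Metric.nhds_basis_closedBall.mem_iff.1
    (Metric.isOpen_ball.mem_nhds (mem_ball_zero_iff.2 ha))
  have hsphere := Metric.sphere_subset_closedBall.trans hsub
  obtain ⟨C, hC⟩ := exists_uniform_bound_eval hE hbdd (isCompact_sphere a r) hsphere
  refine ⟨r⁻¹ + r⁻¹ * |C| * ν.real Set.univ ^ (1 / (2 : ℝ≥0∞).toReal), fun f => ?_⟩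
  set g := shiftNu ν f - a • f with hg
  have hEg {w : ℂ} (hw : w ∈ Metric.ball (0 : ℂ) 1) : E g w = (w - a) * E f w := by
    rw [hg, map_sub, map_smul, Pi.sub_apply, Pi.smul_apply, eval_shiftNu hpoly hbdd hw,
      smul_eq_mul, sub_mul]
  have hpt := norm_le_of_sphere_bound (M := |C| * ‖g‖) hr (hE f) hsub fun w hw => by
    rw [← hEg (hsphere hw)]
    exact (hC w hw g).trans (mul_le_mul_of_nonneg_right (le_abs_self C) (norm_nonneg g))
  have := norm_le_of_ae_le_mul_add ν (f := f) (g := g) (a := r⁻¹) (b := r⁻¹ * (|C| * ‖g‖))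
    (by positivity) (by positivity) (by
      filter_upwards [hae f, hae g] with z h1 h2
      rw [h1, h2, hEg z.2]
      exact hpt z)
  calc ‖f‖ ≤ _ := this
    _ = _ := by rw [Submodule.coe_norm]; ring

/-- Evaluation at `a` kills the range of `S_ν - a` and leaves `c = 0`; the lower bound then gives `f
= 0`. -/
theorem shiftNu_sub_smul_add_eq_zero
    (hE : ∀ f : P2 ν, AnalyticOnNhd ℂ (E f) (Metric.ball 0 1))
    (hae : ∀ f : P2 ν, (f : Lp ℂ 2 ν) =ᵐ[ν] fun z : Disc => E f z)
    (hpoly : ∀ (f : P2 ν) (p : Polynomial ℂ),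
      (f : Lp ℂ 2 ν) =ᵐ[ν] (fun z : Disc => p.eval (z : ℂ)) →
        ∀ z ∈ Metric.ball (0 : ℂ) 1, E f z = p.eval z)
    (hbdd : ∀ w ∈ Metric.ball (0 : ℂ) 1, ∃ C : ℝ, ∀ f : P2 ν, ‖E f w‖ ≤ C * ‖f‖)
    {a : ℂ} (ha : ‖a‖ < 1) {u : P2 ν} (hu : (u : Lp ℂ 2 ν) =ᵐ[ν] fun _ => 1)
    {f : P2 ν} {c : ℂ} (h : shiftNu ν f - a • f + c • u = 0) : f = 0 ∧ c = 0 := by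
  have haD : a ∈ Metric.ball (0 : ℂ) 1 := mem_ball_zero_iff.2 ha
  have hu1 : E u a = 1 := by simpa using hpoly u 1 (by simpa using hu) a haD
  obtain rfl : c = 0 := by
    have := congrFun (congrArg E h) a
    simpa [eval_shiftNu hpoly hbdd haD, hu1] using this
  obtain ⟨C, hC⟩ := shiftNu_sub_bounded_below hE hae hpoly hbdd ha
  rw [zero_smul, add_zero] at h
  have := hC f
  rw [h, norm_zero, mul_zero] at this
  exact ⟨norm_le_zero_iff.1 this, rfl⟩

/-- The scalar is `f(a)`. The lower bound makes the range of `S_ν - a` closed, so `f - f(a)u ∈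
range` is a closed condition on `f`, and only polynomials have to be tested. -/
theorem exists_shiftNu_sub_smul_add
    (hE : ∀ f : P2 ν, AnalyticOnNhd ℂ (E f) (Metric.ball 0 1))
    (hae : ∀ f : P2 ν, (f : Lp ℂ 2 ν) =ᵐ[ν] fun z : Disc => E f z)
    (hpoly : ∀ (f : P2 ν) (p : Polynomial ℂ),
      (f : Lp ℂ 2 ν) =ᵐ[ν] (fun z : Disc => p.eval (z : ℂ)) →
        ∀ z ∈ Metric.ball (0 : ℂ) 1, E f z = p.eval z)
    (hbdd : ∀ w ∈ Metric.ball (0 : ℂ) 1, ∃ C : ℝ, ∀ f : P2 ν, ‖E f w‖ ≤ C * ‖f‖)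
    {a : ℂ} (ha : ‖a‖ < 1) {u : P2 ν} (hu : (u : Lp ℂ 2 ν) =ᵐ[ν] fun _ => 1) (f : P2 ν) :
    ∃ (g : P2 ν) (c : ℂ), shiftNu ν g - a • g + c • u = f := by
  have haD : a ∈ Metric.ball (0 : ℂ) 1 := mem_ball_zero_iff.2 ha
  obtain ⟨C, hC⟩ := shiftNu_sub_bounded_below hE hae hpoly hbdd ha
  let A : P2 ν →L[ℂ] P2 ν := shiftNu ν - a • ContinuousLinearMap.id ℂ (P2 ν)
  have hA (g : P2 ν) : A g = shiftNu ν g - a • g := rfl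
  have hrange : IsClosed (Set.range A) := by
    refine (A.antilipschitz_of_bound (K := C.toNNReal) fun g => ?_).isClosed_range
      A.uniformContinuous
    exact (hC g).trans (mul_le_mul_of_nonneg_right (Real.le_coe_toNNReal C) (norm_nonneg _))
  have hmem : f - E f a • u ∈ Set.range A := by
    refine P2_induction ν (P := fun f => f - E f a • u ∈ Set.range A)
      (hrange.preimage (continuous_id.sub
        ((continuous_eval_of_bound (hbdd a haD)).smul continuous_const))) (fun g p hp => ?_) f
    -- The preimage is the class of the quotient `q = (p - p(a)) / (X - a)`.
    obtain ⟨q, hq⟩ := Polynomial.X_sub_C_dvd_sub_C_eval (a := a) (p := p)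
    obtain ⟨k, hk⟩ := exists_P2_polynomial ν q
    refine ⟨k, Subtype.ext (Lp.ext ?_)⟩
    rw [hA, hpoly g p hp a haD]
    filter_upwards [mulL_sub_smul_apply _ (memLp_coord ν) a (k : Lp ℂ 2 ν), hk, hp, hu,
      Lp.coeFn_sub (g : Lp ℂ 2 ν) (p.eval a • (u : Lp ℂ 2 ν)),
      Lp.coeFn_smul (p.eval a) (u : Lp ℂ 2 ν)] with z h1 h2 h3 h4 h5 h6
    refine h1.trans (Eq.trans ?_ h5.symm)
    rw [h2, Pi.sub_apply, h6, Pi.smul_apply, h3, h4]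
    have := congrArg (Polynomial.eval (z : ℂ)) hq
    simpa using this.symm
  obtain ⟨g, hg⟩ := hmem
  exact ⟨g, E f a, by rw [← hA, hg, sub_add_cancel]⟩

end Evaluation

/-! ### The coupling vector -/

section Coupling

variable (ν : Measure Disc) (hν : HardySubset ν)

theorem hardyEval_hardyOne (z : ℂ) : hardyEval hardyOne z = 1 := by
  have h (n : ℤ) : fourierCoeff ((hardyOne : L2T) : UnitAddCircle → ℂ) n
      = if n = 0 then 1 else 0 := by
    rw [← fourierBasis_repr, fourierBasis.repr_apply_apply, coe_fourierBasis]
    exact orthonormal_iff_ite.1 (orthonormal_fourier (T := 1)) n 0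
  rw [hardyEval, tsum_eq_single 0 fun n hn => by simp [h, hn]]
  simp [h]

theorem embed_hardyOne_coe : (embed ν hν hardyOne : Lp ℂ 2 ν) =ᵐ[ν] fun _ => 1 := by
  filter_upwards [embedLin_coe ν hν hardyOne] with z hz
  exact hz.trans (hardyEval_hardyOne z)

/-- `W` moves the coefficient of index `0` to index `-1`. -/
theorem inner_chiBar_flipHardy (h : hardy) :
    inner ℂ chiBar (flipHardy h) = inner ℂ hardyOne h := by
  have hflip := fourierCoeff_flipL2 (h : L2T) (-1)
  rw [neg_neg, sub_self] at hflip
  rw [inner_hardyOne, ← hflip, ← fourierBasis_repr, fourierBasis.repr_apply_apply, coe_fourierBasis]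
  rfl

/-- `X₀^* χ̄ = J_ν 𝟏`. -/
theorem adjoint_couplingX_chiBar :
    ContinuousLinearMap.adjoint (couplingX ν hν) chiBar = embed ν hν hardyOne := by
  refine ext_inner_right ℂ fun f => ?_
  rw [ContinuousLinearMap.adjoint_inner_left, couplingX, ContinuousLinearMap.comp_apply,
    inner_chiBar_flipHardy, ContinuousLinearMap.adjoint_inner_right]

end Coupling

end QuasiHardy

theorem proposition3p3 (ν : MeasureTheory.Measure QuasiHardy.Disc)
    [MeasureTheory.IsFiniteMeasure ν]
    (hA : QuasiHardy.AnalyticWithBoundedEvaluations ν)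
    (hH : QuasiHardy.HardySubset ν) :
    spectrum ℂ (QuasiHardy.opT ν hH) = Metric.sphere (0 : ℂ) 1 := by
  obtain ⟨E, hE, hae, hpoly, hbdd⟩ := hA
  ext z
  rw [mem_sphere_zero_iff_norm]
  refine ⟨fun hz => le_antisymm ?_ ?_, QuasiHardy.mem_spectrum_opMatrix_of_norm_eq_one _ _⟩
  · refine QuasiHardy.norm_le_one_of_mem_spectrum_opMatrix _ _ ?_ hz
    rw [LinearIsometryEquiv.norm_map]
    exact QuasiHardy.norm_shiftNu_le ν
  · by_contra! hlt
    -- The adjoint of `S_ν^* - z` is `S_ν - z̄`, so the division in `P²(ν)` takes place at `z̄`.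
    have hconj : ‖(starRingEnd ℂ) z‖ < 1 := by rwa [RCLike.norm_conj]
    have hu := QuasiHardy.embed_hardyOne_coe ν hH
    have hinj (g : QuasiHardy.P2 ν) (c : ℂ) :=
      QuasiHardy.shiftNu_sub_smul_add_eq_zero hE hae hpoly hbdd hconj hu (f := g) (c := c)
    have hsurj := QuasiHardy.exists_shiftNu_sub_smul_add hE hae hpoly hbdd hconj hu
    refine QuasiHardy.notMem_spectrum_opMatrix_of_norm_lt_one _ _ hlt (fun f hf => ?_)
      (fun k c => ?_) hz
    · rw [QuasiHardy.adjoint_couplingX_chiBar]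
      refine QuasiHardy.eq_zero_of_adjoint_sub_smul hsurj ?_
      rwa [Complex.conj_conj]
    · rw [QuasiHardy.adjoint_couplingX_chiBar]
      have := QuasiHardy.exists_adjoint_sub_smul hinj hsurj k c
      rwa [Complex.conj_conj] at this
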